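/- Let $Q\in\mathbb R^{n\times n}$ be symmetric positive semidefinite, let $g_1,\dots,g_n:\mathbb R\to(-\infty,+\infty]$ be convex and lower semicontinuous, and let $a_i\in[-\infty,+\infty]$ and $b_i\in[-\infty,+\infty]$ for $i=1,\dots,n$. Consider $$\min_{\alpha\in\mathbb R^n} f(\alpha),\qquad f(\alpha)=\alpha^TQ\alpha+\sum_{i=1}^n g_i(\alpha_i)\quad\text{subject to } a_i\le\alpha_i\le b_i\ (i=1,\dots,n),$$ where $f(\alpha)=+\infty$ if $\alpha$ violates a constraint, and assume $f(0)<+\infty$. Let $S$ be the set of minimizers of $f$, and for $\alpha\in\mathbb R^n$ let $T(\alpha)\in\mathbb R^n$ be a vector with $$T_i(\alpha)\in\operatorname*{arg\,min}_{u\in\mathbb R} f\big(\alpha+(u-\alpha_i)e_i\big),\qquad i=1,\dots,n,$$ where $e_i$ is the $i$-th standard unit vector. Suppose that one of the following conditions holds: (a) $Q$ is positive definite; (b) for every $i$, $g_i$ is strongly convex (with some modulus $m_i>0$) on the set $\{\alpha_i : f(\alpha)\le f(0)\}$ of the values that the $i$-th coordinate takes on the initial level set; (c) for every $i$, $a_i$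 and $b_i$ are finite and $g_i$ is linear (possibly with a constant term) on $[a_i,b_i]$ (for example $g_i(x)=-x$ on $[0,C]$, as in the dual hinge-loss SVM). Then the problem satisfies a global error bound on the initial level set $\{\alpha : f(\alpha)\le f(0)\}$: there is a constant $\kappa>0$ such that for every $\alpha$ with $f(\alpha)\le f(0)$ the Euclidean projection $P_S(\alpha)$ of $\alpha$ to $S$ exists and is unique, $T(\alpha)$ exists, and $$\|\alpha-P_S(\alpha)\|\le\kappa\,\|T(\alpha)-\alpha\|$$ for every choice of $T(\alpha)$, where $\|\cdot\|$ is the Euclidean norm. -/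

import Mathlib

namespace CompositeQP

open Matrix

/-- The box constraint is absorbed into `g`: the value is `⊤` outside `[a, b]`. -/
noncomputable def boxed (g : ℝ → EReal) (a b : EReal) (x : ℝ) : EReal :=
  if a ≤ (x : EReal) ∧ (x : EReal) ≤ b then g x else ⊤

/-- The objective `αᵀ Q α + ∑ i, g i (α i)` under the constraint `a ≤ α ≤ b`,
extended by `⊤` outside the feasible set. -/
noncomputable def objective {n : ℕ} (Q : Matrix (Fin n) (Fin n) ℝ) (g : Fin n → ℝ → EReal)
    (a b : Fin n → EReal) (α : EuclideanSpace ℝ (Fin n)) : EReal :=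
  ((α.ofLp ⬝ᵥ (Q *ᵥ α.ofLp) : ℝ) : EReal) + ∑ i, boxed (g i) (a i) (b i) (α i)

/-- A univariate closed convex function with values in `(-∞, +∞]`: it never takes the value `-∞`,
its epigraph is convex, and it is lower semicontinuous. -/
structure IsClosedConvex (g : ℝ → EReal) : Prop where
  ne_bot : ∀ x, g x ≠ ⊥
  convex_epigraph : Convex ℝ {p : ℝ × ℝ | g p.1 ≤ (p.2 : EReal)}
  lsc : LowerSemicontinuous g

/-- The set of optimal solutions. -/
def solutionSet {n : ℕ} (f : EuclideanSpace ℝ (Fin n) → EReal) :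
    Set (EuclideanSpace ℝ (Fin n)) :=
  {α | ∀ β, f α ≤ f β}

/-- The initial level set `{α | f α ≤ f 0}`. -/
def initialLevelSet {n : ℕ} (f : EuclideanSpace ℝ (Fin n) → EReal) :
    Set (EuclideanSpace ℝ (Fin n)) :=
  {α | f α ≤ f 0}

/-- `p` is a Euclidean projection of `α` to the set `S`. -/
def IsProjection {n : ℕ} (S : Set (EuclideanSpace ℝ (Fin n)))
    (α p : EuclideanSpace ℝ (Fin n)) : Prop :=
  p ∈ S ∧ ∀ s ∈ S, ‖α - p‖ ≤ ‖α - s‖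

/-- `t` is a value of the coordinate minimization operator `T` at `α`: for every `i`,
`t i ∈ argmin_u f (α + (u - α i) e_i)`. -/
def IsCoordMin {n : ℕ} (f : EuclideanSpace ℝ (Fin n) → EReal)
    (α t : EuclideanSpace ℝ (Fin n)) : Prop :=
  ∀ i, ∀ u : ℝ, f (α + EuclideanSpace.single i (t i - α i)) ≤
    f (α + EuclideanSpace.single i (u - α i))

/-- Global error bound from the beginning: there is a constant `κ` such that on the initial level
set the projection `P_S α` to the set of optimal solutions exists and is unique, the coordinate
minimizers `T α` exist, and `‖α - P_S α‖ ≤ κ ‖T α - α‖`. Where a coordinate minimizer is not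
unique (possible only if the objective is constant on a segment of a coordinate line), the
inequality is required for every choice of `T α`. -/
def GlobalErrorBoundFromBeginning {n : ℕ} (f : EuclideanSpace ℝ (Fin n) → EReal) : Prop :=
  ∃ κ : ℝ, 0 < κ ∧ ∀ α ∈ initialLevelSet f,
    (∃! p, IsProjection (solutionSet f) α p) ∧
    (∃ t, IsCoordMin f α t) ∧
    ∀ p t, IsProjection (solutionSet f) α p → IsCoordMin f α t → ‖α - p‖ ≤ κ * ‖t - α‖

/-- Every `g i` is strongly convex on the values that the `i`-th coordinate takes on the initial
level set (where all iterates lie, and where `g i` is finite once `f 0` is). -/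
def StronglyConvexOnIterates {n : ℕ} (g : Fin n → ℝ → EReal)
    (f : EuclideanSpace ℝ (Fin n) → EReal) : Prop :=
  ∀ i, ∃ m : ℝ, 0 < m ∧
    StrongConvexOn ((fun α : EuclideanSpace ℝ (Fin n) => α i) '' initialLevelSet f) m
      (fun x => (g i x).toReal)

/-- Every `g i` is linear (possibly with a constant term) on its box `[a i, b i]`, which has
finite end points. -/
def LinearWithBox {n : ℕ} (g : Fin n → ℝ → EReal) (a b : Fin n → EReal) : Prop :=
  ∀ i, ∃ l u c d : ℝ, a i = (l : EReal) ∧ b i = (u : EReal) ∧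
    ∀ x ∈ Set.Icc l u, g i x = ((c * x + d : ℝ) : EReal)

end CompositeQP

namespace CompositeQP

open Matrix

/-! Write `p` for the projection of `α` and `t` for a coordinate minimizer. Each `t i` satisfies a
one-dimensional variational inequality, and a solution `p` is its own coordinate minimizer. Testing
the inequalities at `α` with `p` and those at `p` with `t`, then adding, cancels the terms `H i` and
leaves `IsSeparableModel.basic_inequality`: the curvature of the objective along the error is
bounded by terms bilinear in the residual `t - α` and in `α - p` or `t - p`.

If `Q` is positive definite or all `g i` are strongly convex, the curvature dominates `‖α - p‖ ^ 2`;
dividing by `‖α - p‖` gives the bound. The same curvature makes the initial level set bounded.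

In the linear case `Q` may be singular, so the basic inequality controls only `quad Q (α - p)`. The
missing directions are governed by the gradient at a solution, a linear form `lin` that is the same
at all solutions. A Hoffman-type bound (`exists_box_error_bound`) gives `κ * ‖α - p‖ ^ 2 ≤ quad Q (α
- p) + lin (α - p) ^ 2`, and the variational inequalities give `0 ≤ lin (α - p) ≤ B * ‖t - α‖`. -/

/-! ### Extended-valued convex functions and their sums. -/

lemma convex_ereal_box (a b : EReal) :
    Convex ℝ {x : ℝ | a ≤ (x : EReal) ∧ (x : EReal) ≤ b} := by
  refine Set.OrdConnected.convex ⟨fun x hx y hy z hz => ⟨hx.1.trans ?_, le_trans ?_ hy.2⟩⟩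
  · exact EReal.coe_le_coe_iff.2 hz.1
  · exact EReal.coe_le_coe_iff.2 hz.2

lemma isClosed_ereal_box (a b : EReal) :
    IsClosed {x : ℝ | a ≤ (x : EReal) ∧ (x : EReal) ≤ b} :=
  (isClosed_le continuous_const continuous_coe_real_ereal).inter
    (isClosed_le continuous_coe_real_ereal continuous_const)

lemma IsClosedConvex.boxed {g : ℝ → EReal} (hg : IsClosedConvex g) (a b : EReal) :
    IsClosedConvex (boxed g a b) where
  ne_bot x := by
    unfold CompositeQP.boxed
    split_ifs
    · exact hg.ne_bot x
    · simp
  convex_epigraph := by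
    have : {p : ℝ × ℝ | CompositeQP.boxed g a b p.1 ≤ (p.2 : EReal)} =
        {p : ℝ × ℝ | g p.1 ≤ (p.2 : EReal)} ∩
          (LinearMap.fst ℝ ℝ ℝ) ⁻¹' {x : ℝ | a ≤ (x : EReal) ∧ (x : EReal) ≤ b} := by
      ext p
      simp only [CompositeQP.boxed, Set.mem_ofPred_eq, Set.mem_inter_iff, Set.mem_preimage,
        LinearMap.fst_apply]
      split_ifs with h
      · simp [h]
      · simp [h]
    rw [this]
    exact hg.convex_epigraph.inter ((convex_ereal_box a b).linear_preimage _)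
  lsc := by
    rw [lowerSemicontinuous_iff_isClosed_preimage]
    intro y
    -- For `y = ⊤` the sublevel set is the whole line, not its intersection with the box.
    by_cases hy : y = ⊤
    · simp [hy]
    have : CompositeQP.boxed g a b ⁻¹' Set.Iic y =
        g ⁻¹' Set.Iic y ∩ {x : ℝ | a ≤ (x : EReal) ∧ (x : EReal) ≤ b} := by
      ext x
      simp only [CompositeQP.boxed, Set.mem_preimage, Set.mem_Iic, Set.mem_inter_iff,
        Set.mem_ofPred_eq]
      split_ifs with h
      · simp [h]
      · simp [h, hy]
    rw [this]
    exact (lowerSemicontinuous_iff_isClosed_preimage.1 hg.lsc y).inter (isClosed_ereal_box a b)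

lemma IsClosedConvex.coe_toReal {g : ℝ → EReal} (hg : IsClosedConvex g) {x : ℝ} (hx : g x ≠ ⊤) :
    ((g x).toReal : EReal) = g x :=
  EReal.coe_toReal hx (hg.ne_bot x)

/-- Convexity of the epigraph, applied to two points of the graph, yields both the convexity of the
domain and the inequality. -/
lemma IsClosedConvex.convexOn_toReal {g : ℝ → EReal} (hg : IsClosedConvex g) :
    ConvexOn ℝ {x | g x ≠ ⊤} (fun x => (g x).toReal) := by
  have key : ∀ x, g x ≠ ⊤ → ∀ y, g y ≠ ⊤ → ∀ s t : ℝ, 0 ≤ s → 0 ≤ t → s + t = 1 →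
      g (s • x + t • y) ≤ ((s • (g x).toReal + t • (g y).toReal : ℝ) : EReal) := by
    intro x hx y hy s t hs ht hst
    exact hg.convex_epigraph (x := (x, (g x).toReal)) (hg.coe_toReal hx).ge
      (y := (y, (g y).toReal)) (hg.coe_toReal hy).ge hs ht hst
  have mem : ∀ x, g x ≠ ⊤ → ∀ y, g y ≠ ⊤ → ∀ s t : ℝ, 0 ≤ s → 0 ≤ t → s + t = 1 →
      g (s • x + t • y) ≠ ⊤ := fun x hx y hy s t hs ht hst =>
    ((key x hx y hy s t hs ht hst).trans_lt (EReal.coe_lt_top _)).ne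
  refine ⟨fun x hx y hy s t hs ht hst => mem x hx y hy s t hs ht hst,
    fun x hx y hy s t hs ht hst => ?_⟩
  rw [← EReal.coe_le_coe_iff, hg.coe_toReal (mem x hx y hy s t hs ht hst)]
  exact key x hx y hy s t hs ht hst

lemma sum_ne_bot {ι : Type*} (s : Finset ι) (v : ι → EReal) (hv : ∀ i, v i ≠ ⊥) :
    ∑ i ∈ s, v i ≠ ⊥ := by
  classical
  induction s using Finset.induction_on with
  | empty => simp
  | insert i s hi ih =>
    rw [Finset.sum_insert hi]
    exact EReal.add_ne_bot_iff.2 ⟨hv i, ih⟩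

lemma sum_eq_top {ι : Type*} (s : Finset ι) (v : ι → EReal) (hv : ∀ i, v i ≠ ⊥) {i : ι}
    (hi : i ∈ s) (h : v i = ⊤) : ∑ j ∈ s, v j = ⊤ := by
  classical
  rw [← Finset.add_sum_erase s v hi, h]
  exact EReal.top_add_of_ne_bot (sum_ne_bot _ v hv)

lemma coe_sum_ereal {ι : Type*} (s : Finset ι) (v : ι → ℝ) :
    ((∑ i ∈ s, v i : ℝ) : EReal) = ∑ i ∈ s, (v i : EReal) :=
  map_sum (AddMonoidHom.mk (ZeroHom.mk Real.toEReal EReal.coe_zero) EReal.coe_add) v s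

lemma lowerSemicontinuous_add_ereal {X : Type*} [TopologicalSpace X] {u v : X → EReal}
    (hu : LowerSemicontinuous u) (hv : LowerSemicontinuous v) (hu' : ∀ x, u x ≠ ⊥)
    (hv' : ∀ x, v x ≠ ⊥) : LowerSemicontinuous fun x => u x + v x :=
  hu.add' hv fun x => EReal.continuousAt_add (Or.inr (hv' x)) (Or.inl (hu' x))

lemma lowerSemicontinuous_sum_ereal {X ι : Type*} [TopologicalSpace X] (s : Finset ι)
    {v : ι → X → EReal} (hv : ∀ i, LowerSemicontinuous (v i)) (hv' : ∀ i x, v i x ≠ ⊥) :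
    LowerSemicontinuous fun x => ∑ i ∈ s, v i x := by
  classical
  induction s using Finset.induction_on with
  | empty => simpa using lowerSemicontinuous_const
  | insert i s hi ih =>
    simp only [Finset.sum_insert hi]
    exact lowerSemicontinuous_add_ereal (hv i) ih (hv' i)
      fun x => sum_ne_bot s _ fun i => hv' i x

/-! ### The real-valued separable model and the quadratic form. -/

/-- The bilinear form of `Q`. -/
def bil {n : ℕ} (Q : Matrix (Fin n) (Fin n) ℝ) (x y : EuclideanSpace ℝ (Fin n)) : ℝ :=
  x.ofLp ⬝ᵥ (Q *ᵥ y.ofLp)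

/-- The quadratic form of `Q`. -/
def quad {n : ℕ} (Q : Matrix (Fin n) (Fin n) ℝ) (x : EuclideanSpace ℝ (Fin n)) : ℝ :=
  bil Q x x

/-- The real-valued objective `xᵀ Q x + ∑ i, H i (x i)`. -/
def value {n : ℕ} (Q : Matrix (Fin n) (Fin n) ℝ) (H : Fin n → ℝ → ℝ)
    (x : EuclideanSpace ℝ (Fin n)) : ℝ :=
  quad Q x + ∑ i, H i (x i)

lemma continuous_quad {n : ℕ} (Q : Matrix (Fin n) (Fin n) ℝ) : Continuous (quad Q) := by
  unfold quad bil
  simp only [dotProduct, mulVec]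
  fun_prop

/-- `f` is the lower semicontinuous extension by `⊤` of the real function
`value Q H` on the product of the sets `D i`, with `H i` convex on `D i ∋ 0`. -/
structure IsSeparableModel {n : ℕ} (f : EuclideanSpace ℝ (Fin n) → EReal)
    (Q : Matrix (Fin n) (Fin n) ℝ) (D : Fin n → Set ℝ) (H : Fin n → ℝ → ℝ) : Prop where
  convexOn : ∀ i, ConvexOn ℝ (D i) (H i)
  zero_mem : ∀ i, (0 : ℝ) ∈ D i
  eq_coe : ∀ α, (∀ i, α i ∈ D i) → f α = (value Q H α : EReal)
  eq_top : ∀ α, (¬ ∀ i, α i ∈ D i) → f α = ⊤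
  lsc : LowerSemicontinuous f

/-- After this point `EReal` enters only through comparisons of values: no summand is `⊥`, so one
infinite summand makes the objective `⊤`, and elsewhere it is real. -/
lemma isSeparableModel_objective {n : ℕ} (Q : Matrix (Fin n) (Fin n) ℝ)
    (g : Fin n → ℝ → EReal) (hg : ∀ i, IsClosedConvex (g i)) (a b : Fin n → EReal)
    (h0 : objective Q g a b 0 < ⊤) :
    IsSeparableModel (objective Q g a b) Q (fun i => {x | boxed (g i) (a i) (b i) x ≠ ⊤})
      (fun i x => (boxed (g i) (a i) (b i) x).toReal) := by
  have hB : ∀ i, IsClosedConvex (boxed (g i) (a i) (b i)) := fun i => (hg i).boxed _ _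
  have htop : ∀ α : EuclideanSpace ℝ (Fin n), (¬ ∀ i, boxed (g i) (a i) (b i) (α i) ≠ ⊤) →
      objective Q g a b α = ⊤ := by
    intro α hα
    push Not at hα
    obtain ⟨i, hi⟩ := hα
    unfold objective
    rw [sum_eq_top _ (fun i => boxed (g i) (a i) (b i) (α i)) (fun i => (hB i).ne_bot _)
      (Finset.mem_univ i) hi]
    exact EReal.coe_add_top _
  refine ⟨fun i => (hB i).convexOn_toReal, fun i => ?_, fun α hα => ?_, htop, ?_⟩
  · by_contra hi
    refine h0.ne (htop 0 fun h => hi ?_)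
    simpa using h i
  · unfold objective value quad bil
    rw [EReal.coe_add]
    congr 1
    rw [coe_sum_ereal]
    exact Finset.sum_congr rfl fun i _ => ((hB i).coe_toReal (hα i)).symm
  · refine lowerSemicontinuous_add_ereal ?_ ?_ (fun _ => EReal.coe_ne_bot _)
      fun α => sum_ne_bot _ _ fun i => (hB i).ne_bot _
    · exact (continuous_coe_real_ereal.comp (continuous_quad Q)).lowerSemicontinuous
    · refine lowerSemicontinuous_sum_ereal _ (fun i => ?_) fun i α => (hB i).ne_bot _
      exact (hB i).lsc.comp (g := fun α : EuclideanSpace ℝ (Fin n) => α i) (by fun_prop)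

section Bilinear

variable {n : ℕ} (Q : Matrix (Fin n) (Fin n) ℝ) (x y z : EuclideanSpace ℝ (Fin n)) (c : ℝ)

lemma bil_add_left : bil Q (x + y) z = bil Q x z + bil Q y z := by
  simp [bil, add_dotProduct]

lemma bil_add_right : bil Q x (y + z) = bil Q x y + bil Q x z := by
  simp [bil, dotProduct_add, mulVec_add]

lemma bil_sub_left : bil Q (x - y) z = bil Q x z - bil Q y z := by
  simp [bil, sub_dotProduct]

lemma bil_sub_right : bil Q x (y - z) = bil Q x y - bil Q x z := by
  simp [bil, dotProduct_sub, mulVec_sub]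

lemma bil_smul_left : bil Q (c • x) y = c * bil Q x y := by
  simp [bil]

lemma bil_smul_right : bil Q x (c • y) = c * bil Q x y := by
  simp [bil, mulVec_smul]

lemma bil_single_left (i : Fin n) : bil Q (EuclideanSpace.single i c) y = c * (Q *ᵥ y.ofLp) i := by
  simp [bil]

lemma bil_comm {Q : Matrix (Fin n) (Fin n) ℝ} (hQ : Q.IsHermitian) : bil Q x y = bil Q y x := by
  have h : Qᵀ = Q := by simpa using hQ.eq
  unfold bil
  rw [dotProduct_mulVec, ← mulVec_transpose, h, dotProduct_comm]

lemma quad_single (i : Fin n) : quad Q (EuclideanSpace.single i c) = Q i i * c ^ 2 := by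
  rw [quad, bil_single_left]
  simp
  ring

lemma bil_diagonal (d : Fin n → ℝ) : bil (diagonal d) x y = ∑ i, d i * x i * y i := by
  simp only [bil, dotProduct, mulVec_diagonal]
  exact Finset.sum_congr rfl fun i _ => by ring

lemma exists_bil_bound : ∃ C : ℝ, 0 ≤ C ∧
    ∀ x y : EuclideanSpace ℝ (Fin n), |bil Q x y| ≤ C * ‖x‖ * ‖y‖ := by
  refine ⟨∑ i, ∑ j, |Q i j|, by positivity, fun x y => ?_⟩
  have hx : ∀ i, |x i| ≤ ‖x‖ := fun i => PiLp.norm_apply_le x i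
  have hy : ∀ i, |y i| ≤ ‖y‖ := fun i => PiLp.norm_apply_le y i
  have : bil Q x y = ∑ i, ∑ j, x i * (Q i j * y j) := by
    simp only [bil, dotProduct, mulVec, Finset.mul_sum]
  rw [this]
  simp only [Finset.sum_mul]
  refine (Finset.abs_sum_le_sum_abs _ _).trans (Finset.sum_le_sum fun i _ => ?_)
  refine (Finset.abs_sum_le_sum_abs _ _).trans (Finset.sum_le_sum fun j _ => ?_)
  rw [abs_mul, abs_mul]
  calc |x i| * (|Q i j| * |y j|) ≤ ‖x‖ * (|Q i j| * ‖y‖) := by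
        gcongr
        · exact hx i
        · exact hy j
    _ = |Q i j| * ‖x‖ * ‖y‖ := by ring

lemma quad_add {Q : Matrix (Fin n) (Fin n) ℝ} (hQ : Q.IsHermitian) :
    quad Q (x + y) = quad Q x + 2 * bil Q y x + quad Q y := by
  simp only [quad, bil_add_left, bil_add_right, bil_comm x y hQ]
  ring

lemma quad_combo {a b : ℝ} (hab : a + b = 1) :
    quad Q (a • x + b • y) = a * quad Q x + b * quad Q y - a * b * quad Q (x - y) := by
  obtain rfl : b = 1 - a := by linarith
  simp only [quad, bil_add_left, bil_add_right, bil_smul_left, bil_smul_right, bil_sub_left,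
    bil_sub_right]
  ring

lemma quad_nonneg {Q : Matrix (Fin n) (Fin n) ℝ} (hQ : Q.PosSemidef) : 0 ≤ quad Q x := by
  simpa [quad, bil] using hQ.dotProduct_mulVec_nonneg x.ofLp

lemma bil_eq_zero_of_quad_eq_zero {Q : Matrix (Fin n) (Fin n) ℝ} (hQ : Q.PosSemidef)
    {x : EuclideanSpace ℝ (Fin n)} (hx : quad Q x = 0) : bil Q y x = 0 := by
  have : Q *ᵥ x.ofLp = 0 := (hQ.dotProduct_mulVec_zero_iff x.ofLp).1 (by simpa [quad, bil] using hx)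
  simp [bil, this]

/-- Compactness of the unit sphere and homogeneity of degree two. -/
lemma exists_quad_lower_bound {Q : Matrix (Fin n) (Fin n) ℝ} (hQ : Q.PosDef) :
    ∃ l : ℝ, 0 < l ∧ ∀ x : EuclideanSpace ℝ (Fin n), l * ‖x‖ ^ 2 ≤ quad Q x := by
  obtain ⟨l, hl, h⟩ := (isCompact_sphere (0 : EuclideanSpace ℝ (Fin n)) 1).exists_forall_le'
    (continuous_quad Q).continuousOn (a := 0) fun x hx => by
      have : x.ofLp ≠ 0 := by
        rintro h0
        have : x = 0 := by ext i; simp [h0]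
        simp [this] at hx
      simpa [quad, bil] using hQ.dotProduct_mulVec_pos this
  refine ⟨l, hl, fun x => ?_⟩
  by_cases hx : x = 0
  · simp [hx, quad, bil]
  have hx' : 0 < ‖x‖ := norm_pos_iff.2 hx
  have := h (‖x‖⁻¹ • x) (by simp [norm_smul, hx'.ne'])
  simp only [quad, bil_smul_left, bil_smul_right] at this ⊢
  rw [← mul_assoc, ← mul_inv, inv_mul_eq_div, le_div_iff₀ (by positivity)] at this
  nlinarith

end Bilinear

/-- The identity `quad_combo` keeps the curvature of `Q` exactly, so that it adds to the modulus `m`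
and the conditions (a) and (b) can be treated together. -/
lemma value_combo_le {n : ℕ} (Q : Matrix (Fin n) (Fin n) ℝ) {E : Fin n → Set ℝ}
    {H : Fin n → ℝ → ℝ} {m : ℝ} (hH : ∀ i, StrongConvexOn (E i) m (H i))
    {x y : EuclideanSpace ℝ (Fin n)} (hx : ∀ i, x i ∈ E i) (hy : ∀ i, y i ∈ E i)
    {a b : ℝ} (ha : 0 ≤ a) (hb : 0 ≤ b) (hab : a + b = 1) :
    value Q H (a • x + b • y) ≤ a * value Q H x + b * value Q H y -
      a * b * (quad Q (x - y) + m / 2 * ‖x - y‖ ^ 2) := by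
  have h : ∑ i, H i ((a • x + b • y) i) ≤ ∑ i, (a * H i (x i) + b * H i (y i) -
      a * b * (m / 2 * (x i - y i) ^ 2)) := by
    refine Finset.sum_le_sum fun i _ => ?_
    simpa using (hH i).2 (hx i) (hy i) ha hb hab
  rw [Finset.sum_sub_distrib, Finset.sum_add_distrib, ← Finset.mul_sum, ← Finset.mul_sum,
    ← Finset.mul_sum, ← Finset.mul_sum] at h
  have hn : ‖x - y‖ ^ 2 = ∑ i, (x i - y i) ^ 2 := by
    simp [EuclideanSpace.norm_sq_eq]
  simp only [value]
  rw [quad_combo Q x y hab, hn]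
  linarith

lemma existsUnique_isProjection {n : ℕ} {S : Set (EuclideanSpace ℝ (Fin n))} (hS : IsCompact S)
    (hne : S.Nonempty) (hconv : Convex ℝ S) (α : EuclideanSpace ℝ (Fin n)) :
    ∃! p, IsProjection S α p := by
  obtain ⟨p, hp, hmin⟩ := hS.exists_isMinOn hne (f := fun s => ‖α - s‖) (by fun_prop)
  refine ⟨p, ⟨hp, fun s hs => hmin hs⟩, fun q hq => ?_⟩
  have h1 : ‖α - q‖ = ‖α - p‖ := le_antisymm (hq.2 p hp) (hmin hq.1)
  have h2 : ‖α - p‖ ≤ ‖α - midpoint ℝ p q‖ := hmin (hconv.midpoint_mem hp hq.1)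
  -- Two distinct nearest points would have a strictly nearer midpoint.
  have h3 := parallelogram_law_with_norm ℝ (α - p) (α - q)
  have h4 : (α - p) + (α - q) = (2 : ℝ) • (α - midpoint ℝ p q) := by
    rw [midpoint_eq_smul_add, invOf_eq_inv]
    module
  have h5 : (α - p) - (α - q) = q - p := by abel
  rw [h4, h5, norm_smul, h1] at h3
  norm_num at h3
  have h6 : ‖q - p‖ = 0 := by nlinarith [norm_nonneg (q - p), norm_nonneg (α - p)]
  exact sub_eq_zero.1 (norm_eq_zero.1 h6)

/-! ### Existence of minimizers from a compact level set. -/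

section Existence

variable {n : ℕ} {f : EuclideanSpace ℝ (Fin n) → EReal}

lemma add_single_sub_self (α : EuclideanSpace ℝ (Fin n)) (i : Fin n) :
    α + EuclideanSpace.single i (α i - α i) = α := by
  ext j
  simp

/-- On a coordinate line the sublevel set of level `f 0` is closed and lies in a coordinate image of
the compact level set, so a minimum is attained there; off it, values exceed `f 0`. -/
lemma exists_isCoordMin (hf : LowerSemicontinuous f) (hL : IsCompact (initialLevelSet f))
    {α : EuclideanSpace ℝ (Fin n)} (hα : α ∈ initialLevelSet f) : ∃ t, IsCoordMin f α t := by
  have key : ∀ i, ∃ t : ℝ, ∀ u : ℝ, f (α + EuclideanSpace.single i (t - α i)) ≤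
      f (α + EuclideanSpace.single i (u - α i)) := by
    intro i
    let γ : ℝ → EuclideanSpace ℝ (Fin n) := fun u => α + EuclideanSpace.single i (u - α i)
    have hγ : Continuous γ := by
      have : γ = fun u => α + (u - α i) • EuclideanSpace.single i (1 : ℝ) := by
        funext u
        ext j
        simp [γ]
      rw [this]
      fun_prop
    have hlsc : LowerSemicontinuous fun u => f (γ u) := hf.comp hγ
    have hK : IsCompact {u | f (γ u) ≤ f 0} := by
      refine (hL.image (f := fun x => x i) (by fun_prop)).of_isClosed_subset
        (lowerSemicontinuous_iff_isClosed_preimage.1 hlsc (f 0)) fun u hu => ?_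
      exact ⟨γ u, hu, by simp [γ]⟩
    have hα' : f (γ (α i)) ≤ f 0 := (congrArg f (add_single_sub_self α i)).trans_le hα
    obtain ⟨t, ht, hmin⟩ := (hlsc.lowerSemicontinuousOn _).exists_isMinOn ⟨α i, hα'⟩ hK
    refine ⟨t, fun u => ?_⟩
    by_cases hu : f (γ u) ≤ f 0
    · exact hmin hu
    · exact le_trans ht (not_le.1 hu).le
  choose t ht using key
  exact ⟨WithLp.toLp 2 t, fun i u => by simpa using ht i u⟩

lemma solutionSet_subset_initialLevelSet : solutionSet f ⊆ initialLevelSet f :=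
  fun _ hα => hα 0

lemma solutionSet_nonempty (hf : LowerSemicontinuous f) (hL : IsCompact (initialLevelSet f)) :
    (solutionSet f).Nonempty := by
  obtain ⟨p, hp, hmin⟩ := (hf.lowerSemicontinuousOn _).exists_isMinOn
    ⟨0, le_refl (f 0)⟩ hL
  refine ⟨p, fun β => ?_⟩
  by_cases hβ : f β ≤ f 0
  · exact hmin hβ
  · exact le_trans hp (not_le.1 hβ).le

lemma isCompact_solutionSet (hf : LowerSemicontinuous f) (hL : IsCompact (initialLevelSet f)) :
    IsCompact (solutionSet f) := by
  refine hL.of_isClosed_subset ?_ solutionSet_subset_initialLevelSet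
  have : solutionSet f = ⋂ β, f ⁻¹' Set.Iic (f β) := by
    ext α
    simp [solutionSet]
  rw [this]
  exact isClosed_iInter fun β => lowerSemicontinuous_iff_isClosed_preimage.1 hf (f β)

lemma isCoordMin_self_of_mem_solutionSet {p : EuclideanSpace ℝ (Fin n)}
    (hp : p ∈ solutionSet f) : IsCoordMin f p p :=
  fun i _ => (congrArg f (add_single_sub_self p i)).trans_le (hp _)

lemma IsCoordMin.mem_initialLevelSet {α t : EuclideanSpace ℝ (Fin n)} (ht : IsCoordMin f α t)
    (hα : α ∈ initialLevelSet f) (i : Fin n) :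
    α + EuclideanSpace.single i (t i - α i) ∈ initialLevelSet f := by
  have := ht i (α i)
  rw [add_single_sub_self] at this
  exact le_trans this hα

end Existence

/-! ### Variational inequalities for coordinate minimizers. -/

section Model

variable {n : ℕ} {f : EuclideanSpace ℝ (Fin n) → EReal} {Q : Matrix (Fin n) (Fin n) ℝ}
  {D : Fin n → Set ℝ} {H : Fin n → ℝ → ℝ}

lemma IsSeparableModel.mem_of_mem_initialLevelSet (hf : IsSeparableModel f Q D H)
    {α : EuclideanSpace ℝ (Fin n)} (hα : α ∈ initialLevelSet f) (i : Fin n) : α i ∈ D i := by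
  by_contra hi
  have h1 : f α ≤ f 0 := hα
  rw [hf.eq_top α fun h => hi (h i), hf.eq_coe 0 hf.zero_mem] at h1
  simp at h1

lemma IsSeparableModel.convex_solutionSet (hf : IsSeparableModel f Q D H) (hQ : Q.PosSemidef) :
    Convex ℝ (solutionSet f) := by
  intro x hx y hy a b ha hb hab β
  have hxD := hf.mem_of_mem_initialLevelSet (solutionSet_subset_initialLevelSet hx)
  have hyD := hf.mem_of_mem_initialLevelSet (solutionSet_subset_initialLevelSet hy)
  have hD : ∀ i, (a • x + b • y) i ∈ D i := fun i => by
    simpa using (hf.convexOn i).1 (hxD i) (hyD i) ha hb hab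
  refine le_trans ?_ (hx β)
  have hxy : value Q H y ≤ value Q H x := by
    have := hy x
    rwa [hf.eq_coe x hxD, hf.eq_coe y hyD, EReal.coe_le_coe_iff] at this
  rw [hf.eq_coe _ hD, hf.eq_coe x hxD, EReal.coe_le_coe_iff]
  have h := value_combo_le Q (fun i => strongConvexOn_zero.2 (hf.convexOn i)) hxD hyD ha hb hab
  have h1 : 0 ≤ a * b * quad Q (x - y) :=
    mul_nonneg (mul_nonneg ha hb) (quad_nonneg _ hQ)
  have h2 : b * value Q H y ≤ b * value Q H x := by gcongr
  have h3 : value Q H x = a * value Q H x + b * value Q H x := by rw [← add_mul, hab, one_mul]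
  linarith

/-- The variational inequality that characterizes a coordinate minimizer. -/
lemma IsSeparableModel.coordMin_inequality (hf : IsSeparableModel f Q D H) (hQ : Q.PosSemidef)
    {E : Fin n → Set ℝ} (hED : ∀ i, E i ⊆ D i) {m : ℝ}
    (hH : ∀ i, StrongConvexOn (E i) m (H i)) {α t : EuclideanSpace ℝ (Fin n)}
    (hα : α ∈ initialLevelSet f) (ht : IsCoordMin f α t) (i : Fin n) (hti : t i ∈ E i) {u : ℝ}
    (hu : u ∈ E i) :
    m / 2 * (u - t i) ^ 2 ≤ H i u - H i (t i) +
      (2 * (Q *ᵥ α.ofLp) i + 2 * Q i i * (t i - α i)) * (u - t i) := by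
  have hαD := hf.mem_of_mem_initialLevelSet hα
  have hval : ∀ w ∈ D i, f (α + EuclideanSpace.single i (w - α i)) =
      ((quad Q α + 2 * (Q *ᵥ α.ofLp) i * (w - α i) + Q i i * (w - α i) ^ 2 +
        (H i w + ∑ j ∈ Finset.univ.erase i, H j (α j)) : ℝ) : EReal) := by
    intro w hw
    rw [hf.eq_coe, value, ← Finset.add_sum_erase _ _ (Finset.mem_univ i), quad_add _ _ hQ.1,
      quad_single, bil_single_left]
    · congr 2
      · ring
      · congr 1
        · simp
        · refine Finset.sum_congr rfl fun j hj => ?_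
          simp [Finset.ne_of_mem_erase hj]
    · intro j
      by_cases hj : j = i
      · subst hj; simpa using hw
      · simpa [hj] using hαD j
  -- Compare `t i` with the point at fraction `s` of the way to `u` and divide by `s`; the remainder
  -- is of order `s` and vanishes as `s` tends to `0` from the right.
  have key : ∀ s ∈ Set.Ioc (0 : ℝ) 1, 0 ≤ H i u - H i (t i) +
      (2 * (Q *ᵥ α.ofLp) i + 2 * Q i i * (t i - α i)) * (u - t i) - m / 2 * (u - t i) ^ 2 +
        s * ((Q i i + m / 2) * (u - t i) ^ 2) := by
    intro s hs
    have hs1 : 0 ≤ 1 - s := by linarith [hs.2]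
    have hwE := (hH i).1 hti hu hs1 hs.1.le (by ring)
    have hconv := (hH i).2 hti hu hs1 hs.1.le (by ring)
    have hmin := ht i ((1 - s) • t i + s • u)
    rw [hval _ (hED i hti), hval _ (hED i hwE), EReal.coe_le_coe_iff] at hmin
    simp only [smul_eq_mul, Real.norm_eq_abs, sq_abs] at hconv hmin
    refine nonneg_of_mul_nonneg_right ?_ hs.1
    nlinarith
  have hlim : Filter.Tendsto (fun s : ℝ => H i u - H i (t i) +
      (2 * (Q *ᵥ α.ofLp) i + 2 * Q i i * (t i - α i)) * (u - t i) - m / 2 * (u - t i) ^ 2 +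
        s * ((Q i i + m / 2) * (u - t i) ^ 2)) (nhdsWithin 0 (Set.Ioi 0))
      (nhds (H i u - H i (t i) +
      (2 * (Q *ᵥ α.ofLp) i + 2 * Q i i * (t i - α i)) * (u - t i) - m / 2 * (u - t i) ^ 2 +
        0 * ((Q i i + m / 2) * (u - t i) ^ 2))) :=
    tendsto_nhdsWithin_of_tendsto_nhds (Continuous.tendsto (by fun_prop) 0)
  have := ge_of_tendsto hlim (Filter.mem_of_superset (Ioc_mem_nhdsGT one_pos) key)
  linarith

/-- The basic estimate, with `α - p` the error and `t - α` the residual. -/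
lemma IsSeparableModel.basic_inequality (hf : IsSeparableModel f Q D H) (hQ : Q.PosSemidef)
    {E : Fin n → Set ℝ} (hED : ∀ i, E i ⊆ D i) {m : ℝ}
    (hH : ∀ i, StrongConvexOn (E i) m (H i))
    (hLE : ∀ x ∈ initialLevelSet f, ∀ i, x i ∈ E i) {α t p : EuclideanSpace ℝ (Fin n)}
    (hα : α ∈ initialLevelSet f) (ht : IsCoordMin f α t) (hp : p ∈ solutionSet f) :
    2 * quad Q (α - p) + 2 * bil Q (t - α) (α - p) +
      2 * bil (diagonal fun i => Q i i) (t - α) (t - p) + m * ‖t - p‖ ^ 2 ≤ 0 := by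
  -- The vector `t` itself may leave the level set, but each `t i` is a coordinate of some point of
  -- it, which is all that `E i` requires.
  have hpL := solutionSet_subset_initialLevelSet hp
  have htE : ∀ i, t i ∈ E i := fun i => by
    simpa using hLE _ (ht.mem_initialLevelSet hα i) i
  have hpE := hLE p hpL
  have hsum : ∑ i, (2 * ((t i - p i) * ((Q *ᵥ α.ofLp) i - (Q *ᵥ p.ofLp) i)) +
      2 * (Q i i * (t i - α i) * (t i - p i)) + m * (t i - p i) ^ 2) ≤ 0 := by
    refine Finset.sum_nonpos fun i _ => ?_
    have h1 := hf.coordMin_inequality hQ hED hH hα ht i (htE i) (hpE i)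
    have h2 := hf.coordMin_inequality hQ hED hH hpL (isCoordMin_self_of_mem_solutionSet hp) i
      (hpE i) (htE i)
    nlinarith
  have e1 : bil Q (t - p) (α - p) =
      ∑ i, (t i - p i) * ((Q *ᵥ α.ofLp) i - (Q *ᵥ p.ofLp) i) := by
    simp [bil, mulVec_sub, dotProduct]
  have e2 : bil (diagonal fun i => Q i i) (t - α) (t - p) =
      ∑ i, Q i i * (t i - α i) * (t i - p i) := by
    simp [bil_diagonal]
  have e3 : ‖t - p‖ ^ 2 = ∑ i, (t i - p i) ^ 2 := by
    simp [EuclideanSpace.norm_sq_eq]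
  have e4 : bil Q (t - p) (α - p) = quad Q (α - p) + bil Q (t - α) (α - p) := by
    rw [quad, ← bil_add_left]
    congr 1
    abel
  rw [Finset.sum_add_distrib, Finset.sum_add_distrib, ← Finset.mul_sum, ← Finset.mul_sum,
    ← Finset.mul_sum, ← e1, ← e2, ← e3, e4] at hsum
  linarith

end Model

lemma exists_pos_forall_le {ι : Type*} [Finite ι] (v : ι → ℝ) (hv : ∀ i, 0 < v i) :
    ∃ r : ℝ, 0 < r ∧ ∀ i, r ≤ v i := by
  cases isEmpty_or_nonempty ι
  · exact ⟨1, one_pos, fun i => isEmptyElim i⟩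
  · obtain ⟨i, hi⟩ := Finite.exists_min v
    exact ⟨v i, hv i, hi⟩

/-! ### Positive definite or strongly convex case. -/

section StronglyConvex

variable {n : ℕ} {f : EuclideanSpace ℝ (Fin n) → EReal} {Q : Matrix (Fin n) (Fin n) ℝ}
  {D : Fin n → Set ℝ} {H : Fin n → ℝ → ℝ}

lemma IsSeparableModel.isClosed_initialLevelSet (hf : IsSeparableModel f Q D H) :
    IsClosed (initialLevelSet f) :=
  lowerSemicontinuous_iff_isClosed_preimage.1 hf.lsc (f 0)

lemma IsSeparableModel.mem_initialLevelSet_iff (hf : IsSeparableModel f Q D H)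
    {x : EuclideanSpace ℝ (Fin n)} (hx : ∀ i, x i ∈ D i) :
    x ∈ initialLevelSet f ↔ value Q H x ≤ value Q H 0 := by
  change f x ≤ f 0 ↔ _
  rw [hf.eq_coe x hx, hf.eq_coe 0 hf.zero_mem, EReal.coe_le_coe_iff]

/-- For a distant `x` in the level set, curvature along the segment from `0` to `x` forces a drop
proportional to `‖x‖ - 1` at unit distance from `0`, whereas the objective is bounded below on the
unit ball. -/
lemma IsSeparableModel.isCompact_initialLevelSet (hf : IsSeparableModel f Q D H)
    {E : Fin n → Set ℝ} {m l : ℝ} (hH : ∀ i, StrongConvexOn (E i) m (H i))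
    (hLE : ∀ x ∈ initialLevelSet f, ∀ i, x i ∈ E i)
    (hl : ∀ x, l * ‖x‖ ^ 2 ≤ quad Q x) (hpos : 0 < l + m / 2) :
    IsCompact (initialLevelSet f) := by
  have h0L : (0 : EuclideanSpace ℝ (Fin n)) ∈ initialLevelSet f := le_refl (f 0)
  have hcpt : IsCompact (initialLevelSet f ∩ Metric.closedBall 0 1) :=
    (isCompact_closedBall _ _).inter_left hf.isClosed_initialLevelSet
  obtain ⟨q, hq, hmin⟩ := LowerSemicontinuousOn.exists_isMinOn
    (⟨0, h0L, by simp⟩ : (initialLevelSet f ∩ Metric.closedBall 0 1).Nonempty) hcpt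
    (hf.lsc.lowerSemicontinuousOn _)
  have hqD := hf.mem_of_mem_initialLevelSet hq.1
  have hq0 := (hf.mem_initialLevelSet_iff hqD).1 hq.1
  refine (isCompact_closedBall (0 : EuclideanSpace ℝ (Fin n))
    (1 + (value Q H 0 - value Q H q) / (l + m / 2))).of_isClosed_subset
    hf.isClosed_initialLevelSet fun x hx => ?_
  rw [mem_closedBall_zero_iff]
  have hxD := hf.mem_of_mem_initialLevelSet hx
  by_cases hx1 : ‖x‖ ≤ 1
  · have : 0 ≤ (value Q H 0 - value Q H q) / (l + m / 2) := div_nonneg (by linarith) hpos.le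
    linarith
  push Not at hx1
  have hs0 : 0 ≤ ‖x‖⁻¹ := by positivity
  have hs1 : 0 ≤ 1 - ‖x‖⁻¹ := by linarith [inv_le_one_of_one_le₀ hx1.le]
  -- The point where the segment from `0` to `x` meets the unit sphere.
  set y : EuclideanSpace ℝ (Fin n) := (1 - ‖x‖⁻¹) • 0 + ‖x‖⁻¹ • x with hy
  have hcombo := value_combo_le Q hH (hLE 0 h0L) (hLE x hx) hs1 hs0 (by ring)
  rw [← hy, zero_sub, norm_neg] at hcombo
  have hquad : quad Q (-x) = quad Q x := by simp [quad, bil, mulVec_neg]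
  have hs : (1 - ‖x‖⁻¹) * ‖x‖⁻¹ * ((l + m / 2) * ‖x‖ ^ 2) = (‖x‖ - 1) * (l + m / 2) := by
    field_simp
  have hle : (1 - ‖x‖⁻¹) * ‖x‖⁻¹ * ((l + m / 2) * ‖x‖ ^ 2) ≤
      (1 - ‖x‖⁻¹) * ‖x‖⁻¹ * (quad Q (-x) + m / 2 * ‖x‖ ^ 2) := by
    refine mul_le_mul_of_nonneg_left ?_ (mul_nonneg hs1 hs0)
    rw [hquad]
    linarith [hl x]
  have hx0 : ‖x‖⁻¹ * value Q H x ≤ ‖x‖⁻¹ * value Q H 0 :=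
    mul_le_mul_of_nonneg_left ((hf.mem_initialLevelSet_iff hxD).1 hx) hs0
  have hyV : value Q H y ≤ value Q H 0 - (‖x‖ - 1) * (l + m / 2) := by linarith
  have hyD : ∀ i, y i ∈ D i := fun i => by
    simpa [hy] using (hf.convexOn i).1 (hf.zero_mem i) (hxD i) hs1 hs0 (by ring)
  have hyL : y ∈ initialLevelSet f :=
    (hf.mem_initialLevelSet_iff hyD).2 (by nlinarith)
  have hyB : y ∈ Metric.closedBall (0 : EuclideanSpace ℝ (Fin n)) 1 := by
    rw [mem_closedBall_zero_iff, hy, smul_zero, zero_add, norm_smul, norm_inv, norm_norm,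
      inv_mul_cancel₀ (by positivity)]
  have hqy : value Q H q ≤ value Q H y := by
    have : f q ≤ f y := hmin ⟨hyL, hyB⟩
    rwa [hf.eq_coe q hqD, hf.eq_coe y hyD, EReal.coe_le_coe_iff] at this
  have : ‖x‖ - 1 ≤ (value Q H 0 - value Q H q) / (l + m / 2) := by
    rw [le_div_iff₀ hpos]
    linarith
  linarith

lemma IsSeparableModel.globalErrorBound_of_estimate (hf : IsSeparableModel f Q D H)
    (hQ : Q.PosSemidef) (hL : IsCompact (initialLevelSet f)) {κ : ℝ} (hκ : 0 < κ)
    (h : ∀ α ∈ initialLevelSet f, ∀ p t, IsProjection (solutionSet f) α p → IsCoordMin f α t →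
      ‖α - p‖ ≤ κ * ‖t - α‖) : GlobalErrorBoundFromBeginning f :=
  ⟨κ, hκ, fun α hα => ⟨existsUnique_isProjection (isCompact_solutionSet hf.lsc hL)
    (solutionSet_nonempty hf.lsc hL) (hf.convex_solutionSet hQ) α,
    exists_isCoordMin hf.lsc hL hα, h α hα⟩⟩

lemma IsSeparableModel.globalErrorBound_of_stronglyConvex (hf : IsSeparableModel f Q D H)
    (hQ : Q.PosSemidef) {E : Fin n → Set ℝ} (hED : ∀ i, E i ⊆ D i) {m l : ℝ} (hm : 0 ≤ m)
    (hl0 : 0 ≤ l) (hlm : 0 < l + m) (hH : ∀ i, StrongConvexOn (E i) m (H i))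
    (hLE : ∀ x ∈ initialLevelSet f, ∀ i, x i ∈ E i)
    (hl : ∀ x, l * ‖x‖ ^ 2 ≤ quad Q x) : GlobalErrorBoundFromBeginning f := by
  obtain ⟨C, hC, hCb⟩ := exists_bil_bound Q
  obtain ⟨C', hC', hCb'⟩ := exists_bil_bound (diagonal fun i => Q i i)
  have hr : 0 < 2 * l + m / 4 := by linarith
  have hK : 0 ≤ (2 * C + 3 * C') / (2 * l + m / 4) := by positivity
  refine hf.globalErrorBound_of_estimate hQ
    (hf.isCompact_initialLevelSet hH hLE hl (by linarith))
    (κ := 2 + (2 * C + 3 * C') / (2 * l + m / 4)) (by positivity) fun α hα p t hp ht => ?_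
  have hb := hf.basic_inequality hQ hED hH hLE hα ht hp.1
  have h1 := neg_le_of_abs_le (hCb (t - α) (α - p))
  have h2 := neg_le_of_abs_le (hCb' (t - α) (t - p))
  have h3 := hl (α - p)
  have h4 : ‖t - p‖ ≤ ‖t - α‖ + ‖α - p‖ := norm_sub_le_norm_sub_add_norm_sub t α p
  have h5 : ‖α - p‖ ≤ ‖t - α‖ + ‖t - p‖ := by
    have := norm_sub_le_norm_sub_add_norm_sub α t p
    rwa [norm_sub_rev α t] at this
  have hz := norm_nonneg (α - p)
  have hd := norm_nonneg (t - α)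
  have hw := norm_nonneg (t - p)
  generalize ‖α - p‖ = z at *
  generalize ‖t - α‖ = d at *
  generalize ‖t - p‖ = w at *
  -- Otherwise `z / 2 ≤ w ≤ 3 / 2 * z`: the lower bound turns `m * w ^ 2` into `m / 4 * z ^ 2`, the
  -- upper one turns `2 * C'` into `3 * C'`.
  by_cases hzd : z ≤ 2 * d
  · nlinarith
  push Not at hzd
  have hzpos : 0 < z := by linarith
  have hw1 : z / 2 ≤ w := by linarith
  have hw2 : w ≤ 3 / 2 * z := by linarith
  have h6 : m * (z / 2) ^ 2 ≤ m * w ^ 2 := by gcongr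
  have h7 : C' * d * w ≤ C' * d * (3 / 2 * z) := by gcongr
  have h8 : (2 * l + m / 4) * z * z ≤ (2 * C + 3 * C') * d * z := by nlinarith
  have h9 := le_of_mul_le_mul_right h8 hzpos
  have h10 : z ≤ (2 * C + 3 * C') / (2 * l + m / 4) * d := by
    rw [div_mul_eq_mul_div, le_div_iff₀ hr]
    linarith
  linarith

end StronglyConvex

/-! ### A Hoffman-type bound over a box. -/

/-- A Hoffman-type bound: if a subset `S` of a box contains with every point all feasible
displacements along which the quadratic function `φ ≥ 0` vanishes, then `φ` controls the distance
of the points of the box to `S`. -/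
lemma exists_box_error_bound {n : ℕ} (l u : Fin n → ℝ) {φ : EuclideanSpace ℝ (Fin n) → ℝ}
    (hφ : Continuous φ) (hhom : ∀ (r : ℝ) x, φ (r • x) = r ^ 2 * φ x) (hnn : ∀ x, 0 ≤ φ x)
    {S : Set (EuclideanSpace ℝ (Fin n))} (hS : ∀ p ∈ S, ∀ i, p i ∈ Set.Icc (l i) (u i))
    (hstep : ∀ p ∈ S, ∀ d, φ d = 0 → (∀ i, (p + d) i ∈ Set.Icc (l i) (u i)) → p + d ∈ S) :
    ∃ κ : ℝ, 0 < κ ∧ ∀ α p, (∀ i, α i ∈ Set.Icc (l i) (u i)) → IsProjection S α p →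
      κ * ‖α - p‖ ^ 2 ≤ φ (α - p) := by
  -- `J` lists the lower and upper bounds active at `p`, and `C J` is the cone of feasible
  -- directions there. `M J` keeps those directions that make no acute angle with any feasible
  -- direction in the kernel of `φ`.
  let C : Set (Fin n) × Set (Fin n) → Set (EuclideanSpace ℝ (Fin n)) := fun J =>
    {d | (∀ i ∈ J.1, 0 ≤ d i) ∧ ∀ i ∈ J.2, d i ≤ 0}
  let M : Set (Fin n) × Set (Fin n) → Set (EuclideanSpace ℝ (Fin n)) := fun J =>
    C J ∩ {d | ∀ e ∈ C J, φ e = 0 → inner ℝ d e ≤ 0}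
  have hM : ∀ J, ∃ r : ℝ, 0 < r ∧ ∀ d ∈ M J, ‖d‖ = 1 → r ≤ φ d := by
    intro J
    have hCc : IsClosed (C J) := by
      simp only [C, Set.ofPred_and, Set.ofPred_forall]
      refine IsClosed.inter ?_ ?_
      · exact isClosed_biInter fun i _ => isClosed_le continuous_const (by fun_prop)
      · exact isClosed_biInter fun i _ => isClosed_le (by fun_prop) continuous_const
    have hMc : IsClosed (M J) := by
      refine hCc.inter ?_
      simp only [Set.ofPred_forall]
      exact isClosed_iInter fun e => isClosed_iInter fun _ => isClosed_iInter fun _ =>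
        isClosed_le (by fun_prop) continuous_const
    obtain ⟨r, hr, h⟩ := ((isCompact_sphere (0 : EuclideanSpace ℝ (Fin n)) 1).inter_left
      -- A unit vector of `M J` with `φ d = 0` could be tested against itself, giving `‖d‖ ^ 2 ≤ 0`.
      hMc).exists_forall_le' hφ.continuousOn (a := 0) fun d hd => by
        refine lt_of_le_of_ne (hnn d) fun h0 => ?_
        have h1 := hd.1.2 d hd.1.1 h0.symm
        have h2 : ‖d‖ = 1 := by simpa using hd.2
        rw [real_inner_self_eq_norm_sq, h2] at h1
        norm_num at h1
    exact ⟨r, hr, fun d hd hd1 => h d ⟨hd, by simpa using hd1⟩⟩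
  choose r hr hrM using hM
  -- There are finitely many patterns `J`, so one constant serves for all of them.
  obtain ⟨κ, hκ, hκr⟩ := exists_pos_forall_le r hr
  refine ⟨κ, hκ, fun α p hα hp => ?_⟩
  by_cases hz : α - p = 0
  · simpa [hz] using hnn 0
  have hz' : 0 < ‖α - p‖ := norm_pos_iff.2 hz
  have hpbox := hS p hp.1
  set J : Set (Fin n) × Set (Fin n) := ({i | p i = l i}, {i | p i = u i}) with hJ
  -- For small `s > 0` the point `p + s • e` stays in the box, hence in `S`. Since it is no nearer
  -- to `α` than `p` is, `2 * ⟪α - p, e⟫ ≤ s * ‖e‖ ^ 2`; then `s` tends to `0`.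
  have hpolar : ∀ e ∈ C J, φ e = 0 → inner ℝ (α - p) e ≤ 0 := by
    intro e he he0
    have hfeas : ∀ᶠ s : ℝ in nhdsWithin 0 (Set.Ioi 0),
        ∀ i, (p + s • e) i ∈ Set.Icc (l i) (u i) := by
      rw [Filter.eventually_all]
      intro i
      have hcont : Filter.Tendsto (fun s : ℝ => p i + s * e i) (nhdsWithin 0 (Set.Ioi 0))
          (nhds (p i)) := by
        refine tendsto_nhdsWithin_of_tendsto_nhds ?_
        have : Continuous fun s : ℝ => p i + s * e i := by fun_prop
        simpa using this.tendsto 0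
      have hlow : ∀ᶠ s : ℝ in nhdsWithin 0 (Set.Ioi 0), l i ≤ p i + s * e i := by
        rcases (hpbox i).1.eq_or_lt with h | h
        · filter_upwards [self_mem_nhdsWithin] with s hs
          have := mul_nonneg (le_of_lt hs) (he.1 i h.symm)
          linarith
        · exact (hcont.eventually_const_lt h).mono fun _ => le_of_lt
      have hup : ∀ᶠ s : ℝ in nhdsWithin 0 (Set.Ioi 0), p i + s * e i ≤ u i := by
        rcases (hpbox i).2.eq_or_lt with h | h
        · filter_upwards [self_mem_nhdsWithin] with s hs
          have := mul_nonpos_of_nonneg_of_nonpos (le_of_lt hs) (he.2 i h)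
          linarith
        · exact (hcont.eventually_lt_const h).mono fun _ => le_of_lt
      filter_upwards [hlow, hup] with s h1 h2
      simpa using ⟨h1, h2⟩
    have hlim : Filter.Tendsto (fun s : ℝ => s * ‖e‖ ^ 2) (nhdsWithin 0 (Set.Ioi 0))
        (nhds 0) := by
      refine tendsto_nhdsWithin_of_tendsto_nhds ?_
      have : Continuous fun s : ℝ => s * ‖e‖ ^ 2 := by fun_prop
      simpa using this.tendsto 0
    have h2 : 2 * inner ℝ (α - p) e ≤ 0 := by
      refine ge_of_tendsto hlim ?_
      filter_upwards [hfeas, self_mem_nhdsWithin] with s hs hs0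
      have hs0' : 0 < s := hs0
      have hmem := hstep p hp.1 (s • e) (by rw [hhom, he0, mul_zero]) hs
      have hle := hp.2 _ hmem
      have heq : α - (p + s • e) = (α - p) - s • e := by abel
      have hsq := norm_sub_sq_real (α - p) (s • e)
      rw [heq] at hle
      rw [inner_smul_right, norm_smul, Real.norm_eq_abs, abs_of_pos hs0'] at hsq
      have : ‖α - p‖ ^ 2 ≤ ‖α - p - s • e‖ ^ 2 := by gcongr
      refine le_of_mul_le_mul_left ?_ hs0'
      nlinarith
    linarith
  have hcone : ‖α - p‖⁻¹ • (α - p) ∈ C J := by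
    refine ⟨fun i hi => ?_, fun i hi => ?_⟩
    · have h1 : p i = l i := hi
      have h2 := (hα i).1
      simp only [PiLp.smul_apply, PiLp.sub_apply, smul_eq_mul]
      exact mul_nonneg (by positivity) (by linarith)
    · have h1 : p i = u i := hi
      have h2 := (hα i).2
      simp only [PiLp.smul_apply, PiLp.sub_apply, smul_eq_mul]
      exact mul_nonpos_of_nonneg_of_nonpos (by positivity) (by linarith)
  have hunit : ‖‖α - p‖⁻¹ • (α - p)‖ = 1 := by
    rw [norm_smul, norm_inv, norm_norm, inv_mul_cancel₀ hz'.ne']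
  have hfin := (hκr J).trans (hrM J _ ⟨hcone, fun e he he0 => by
    rw [real_inner_smul_left]
    exact mul_nonpos_of_nonneg_of_nonpos (by positivity) (hpolar e he he0)⟩ hunit)
  rwa [hhom, inv_pow, inv_mul_eq_div, le_div_iff₀ (by positivity)] at hfin

lemma norm_le_of_mem_box {n : ℕ} {l u : Fin n → ℝ} {x : EuclideanSpace ℝ (Fin n)}
    (hx : ∀ i, x i ∈ Set.Icc (l i) (u i)) :
    ‖x‖ ≤ √(∑ i, (|l i| + |u i|) ^ 2) := by
  rw [EuclideanSpace.norm_eq]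
  refine Real.sqrt_le_sqrt (Finset.sum_le_sum fun i _ => ?_)
  refine pow_le_pow_left₀ (norm_nonneg _) ?_ 2
  rw [Real.norm_eq_abs, abs_le]
  constructor
  · linarith [(hx i).1, neg_abs_le (l i), abs_nonneg (u i)]
  · linarith [(hx i).2, le_abs_self (u i), abs_nonneg (l i)]

/-! ### Linear case on a bounded box. -/

section LinearBox

variable {n : ℕ} {f : EuclideanSpace ℝ (Fin n) → EReal} {Q : Matrix (Fin n) (Fin n) ℝ}
  {D : Fin n → Set ℝ} {H : Fin n → ℝ → ℝ}

/-- The basic inequality with zero residual gives `quad Q (p - q) ≤ 0`, so `p - q` lies in the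
kernel of `Q`. Hence the gradient is the same at all solutions. -/
lemma IsSeparableModel.bil_eq_of_mem_solutionSet (hf : IsSeparableModel f Q D H)
    (hQ : Q.PosSemidef) {p q : EuclideanSpace ℝ (Fin n)} (hp : p ∈ solutionSet f)
    (hq : q ∈ solutionSet f) (x : EuclideanSpace ℝ (Fin n)) : bil Q x p = bil Q x q := by
  have h := hf.basic_inequality hQ (fun i => subset_rfl)
    (fun i => strongConvexOn_zero.2 (hf.convexOn i))
    (fun x hx => hf.mem_of_mem_initialLevelSet hx)
    (solutionSet_subset_initialLevelSet hp) (isCoordMin_self_of_mem_solutionSet hp) hq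
  have h0 : quad Q (p - q) = 0 := by
    have : ∀ M : Matrix (Fin n) (Fin n) ℝ, ∀ y, bil M 0 y = 0 := fun M y => by simp [bil]
    rw [sub_self, this, this] at h
    linarith [quad_nonneg (p - q) hQ]
  have := bil_eq_zero_of_quad_eq_zero x hQ h0
  rw [bil_sub_right] at this
  linarith

/-- The variational inequality of a coordinate minimizer, summed over the coordinates, in the case
of linear `H i`. -/
lemma IsSeparableModel.linear_inequality (hf : IsSeparableModel f Q D H) (hQ : Q.PosSemidef)
    {c : EuclideanSpace ℝ (Fin n)} {d : Fin n → ℝ}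
    (hH : ∀ i, ∀ x ∈ D i, H i x = c i * x + d i) {α t : EuclideanSpace ℝ (Fin n)}
    (hα : α ∈ initialLevelSet f) (ht : IsCoordMin f α t) {y : EuclideanSpace ℝ (Fin n)}
    (hy : ∀ i, y i ∈ D i) :
    0 ≤ inner ℝ c (y - t) + 2 * bil Q (y - t) α +
      2 * bil (diagonal fun i => Q i i) (t - α) (y - t) := by
  have htD : ∀ i, t i ∈ D i := fun i => by
    simpa using hf.mem_of_mem_initialLevelSet (ht.mem_initialLevelSet hα i) i
  have hsum : 0 ≤ ∑ i, (c i * (y i - t i) + 2 * ((y i - t i) * (Q *ᵥ α.ofLp) i) +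
      2 * (Q i i * (t i - α i) * (y i - t i))) := by
    refine Finset.sum_nonneg fun i _ => ?_
    have h := hf.coordMin_inequality hQ (fun i => subset_rfl)
      (fun i => strongConvexOn_zero.2 (hf.convexOn i)) hα ht i (htD i) (hy i)
    rw [hH i _ (hy i), hH i _ (htD i)] at h
    linarith
  rw [Finset.sum_add_distrib, Finset.sum_add_distrib, ← Finset.mul_sum, ← Finset.mul_sum] at hsum
  have e1 : inner ℝ c (y - t) = ∑ i, c i * (y i - t i) := by
    simp [PiLp.inner_apply, mul_comm]
  have e2 : bil Q (y - t) α = ∑ i, (y i - t i) * (Q *ᵥ α.ofLp) i := by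
    simp [bil, dotProduct]
  rw [e1, e2, bil_diagonal]
  simpa using hsum

lemma IsSeparableModel.globalErrorBound_of_linear (hf : IsSeparableModel f Q D H)
    (hQ : Q.PosSemidef) {l u d : Fin n → ℝ} {c : EuclideanSpace ℝ (Fin n)}
    (hD : ∀ i, D i = Set.Icc (l i) (u i)) (hH : ∀ i, ∀ x ∈ D i, H i x = c i * x + d i) :
    GlobalErrorBoundFromBeginning f := by
  have hbox : ∀ x ∈ initialLevelSet f, ∀ i, x i ∈ Set.Icc (l i) (u i) := fun x hx i =>
    hD i ▸ hf.mem_of_mem_initialLevelSet hx i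
  have hSL := solutionSet_subset_initialLevelSet (f := f)
  have hL : IsCompact (initialLevelSet f) :=
    (isCompact_closedBall 0 (√(∑ i, (|l i| + |u i|) ^ 2))).of_isClosed_subset
      hf.isClosed_initialLevelSet fun x hx =>
        mem_closedBall_zero_iff.2 (norm_le_of_mem_box (hbox x hx))
  obtain ⟨x, hx⟩ := solutionSet_nonempty hf.lsc hL
  obtain ⟨C, hC, hCb⟩ := exists_bil_bound Q
  obtain ⟨C', hC', hCb'⟩ := exists_bil_bound (diagonal fun i => Q i i)
  set R := √(∑ i, (|l i| + |u i|) ^ 2) with hR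
  have hR0 : 0 ≤ R := Real.sqrt_nonneg _
  -- The derivative of the objective at the solution `x`, as a linear form.
  let lin : EuclideanSpace ℝ (Fin n) → ℝ := fun z => inner ℝ c z + 2 * bil Q z x
  have hlin : Continuous lin := by
    have : Continuous fun z => bil Q z x := by
      unfold bil
      simp only [dotProduct]
      fun_prop
    fun_prop
  have hnn : ∀ z, 0 ≤ quad Q z + lin z ^ 2 := fun z =>
    add_nonneg (quad_nonneg z hQ) (sq_nonneg _)
  -- Where this `φ` vanishes, `Q e = 0` and `c` is orthogonal to `e`, so a feasible step along `e`
  -- leaves the objective unchanged and stays in the solution set.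
  obtain ⟨κ, hκ, hκb⟩ := exists_box_error_bound l u (φ := fun z => quad Q z + lin z ^ 2)
    ((continuous_quad Q).add (hlin.pow 2))
    (fun r z => by
      simp only [lin, quad, bil_smul_left, bil_smul_right, inner_smul_right]
      ring)
    hnn (S := solutionSet f) (fun p hp => hbox p (hSL hp))
    (fun p hp e he hpe => by
      have hq : quad Q e = 0 := by nlinarith [quad_nonneg e hQ, sq_nonneg (lin e)]
      have hb : ∀ y, bil Q e y = 0 := fun y => by
        rw [bil_comm _ _ hQ.1, bil_eq_zero_of_quad_eq_zero y hQ hq]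
      have hl0 : lin e = 0 := by
        have : lin e ^ 2 = 0 := by linarith
        exact pow_eq_zero_iff two_ne_zero |>.1 this
      have hc : ∑ i, c i * e i = 0 := by
        simpa [lin, hb, PiLp.inner_apply, mul_comm] using hl0
      have hpD := hf.mem_of_mem_initialLevelSet (hSL hp)
      have hpeD : ∀ i, (p + e) i ∈ D i := fun i => by rw [hD i]; exact hpe i
      have hval : value Q H (p + e) = value Q H p := by
        have hs : ∑ i, H i ((p + e) i) = ∑ i, (H i (p i) + c i * e i) := by
          refine Finset.sum_congr rfl fun i _ => ?_
          rw [hH i _ (hpeD i), hH i _ (hpD i), PiLp.add_apply]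
          ring
        rw [value, quad_add _ _ hQ.1, hb, hq, hs, Finset.sum_add_distrib, hc, value]
        ring
      intro β
      rw [hf.eq_coe _ hpeD, hval, ← hf.eq_coe _ hpD]
      exact hp β)
  set B := ‖c‖ + 2 * C * R + 4 * C' * R with hB
  have hB0 : 0 ≤ B := by positivity
  refine hf.globalErrorBound_of_estimate hQ hL
    (κ := (C + 2 * C' + B ^ 2) / κ + 1) (by positivity) fun α hα p t hp ht => ?_
  have hpL := hSL hp.1
  have htD : ∀ i, t i ∈ Set.Icc (l i) (u i) := fun i => by
    simpa using hbox _ (ht.mem_initialLevelSet hα i) i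
  have hnt := norm_le_of_mem_box htD
  have hnp := norm_le_of_mem_box (hbox p hpL)
  have hnα := norm_le_of_mem_box (hbox α hα)
  rw [← hR] at hnt hnp hnα
  have hlinz : lin (α - p) = inner ℝ c (α - p) + 2 * bil Q (α - p) p := by
    simp only [lin, hf.bil_eq_of_mem_solutionSet hQ hx hp.1]
  -- First-order optimality of `p`, tested at `α`; the sign is needed to square the upper bound.
  have hlow : 0 ≤ lin (α - p) := by
    have h := hf.linear_inequality hQ hH hpL (isCoordMin_self_of_mem_solutionSet hp.1)
      (hf.mem_of_mem_initialLevelSet hα)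
    have h0 : bil (diagonal fun i => Q i i) (p - p) (α - p) = 0 := by simp [bil]
    rw [hlinz]
    linarith
  -- The inequality of `t` tested at `p`: the term `- 2 * quad Q (α - p)` has a favourable sign and
  -- is dropped, and `R` bounds every vector of the box.
  have hup : lin (α - p) ≤ B * ‖t - α‖ := by
    have h := hf.linear_inequality hQ hH hα ht (hf.mem_of_mem_initialLevelSet hpL)
    have e1 : p - t = -(α - p) - (t - α) := by abel
    have e2 : bil Q (-(α - p)) α = - bil Q (α - p) p - quad Q (α - p) := by
      have : bil Q (-(α - p)) α = - bil Q (α - p) α := by simp [bil]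
      rw [this, quad, bil_sub_right Q (α - p) α p]
      ring
    have h1 : inner ℝ c (p - t) = - inner ℝ c (α - p) - inner ℝ c (t - α) := by
      rw [e1, inner_sub_right, inner_neg_right]
    have h2 : bil Q (p - t) α = - bil Q (α - p) p - quad Q (α - p) - bil Q (t - α) α := by
      rw [e1, bil_sub_left, e2]
    have h3 := neg_le_of_abs_le (abs_real_inner_le_norm c (t - α))
    have h4 := neg_le_of_abs_le (hCb (t - α) α)
    have h5 := le_of_abs_le (hCb' (t - α) (p - t))
    have h6 : ‖p - t‖ ≤ 2 * R := (norm_sub_le p t).trans (by linarith)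
    have h7 : C * ‖t - α‖ * ‖α‖ ≤ C * ‖t - α‖ * R := by gcongr
    have h8 : C' * ‖t - α‖ * ‖p - t‖ ≤ C' * ‖t - α‖ * (2 * R) := by gcongr
    have h9 := quad_nonneg (α - p) hQ
    rw [hlinz, hB]
    linarith
  have hquad : quad Q (α - p) ≤ C * ‖t - α‖ * ‖α - p‖ + C' * ‖t - α‖ * ‖t - p‖ := by
    have h := hf.basic_inequality hQ (fun i => subset_rfl)
      (fun i => strongConvexOn_zero.2 (hf.convexOn i))
      (fun x hx => hf.mem_of_mem_initialLevelSet hx) hα ht hp.1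
    have h1 := neg_le_of_abs_le (hCb (t - α) (α - p))
    have h2 := neg_le_of_abs_le (hCb' (t - α) (t - p))
    linarith
  have hmain := hκb α p (hbox α hα) hp
  have hsq : lin (α - p) ^ 2 ≤ (B * ‖t - α‖) ^ 2 := by gcongr
  have htp : ‖t - p‖ ≤ ‖t - α‖ + ‖α - p‖ := norm_sub_le_norm_sub_add_norm_sub t α p
  have hK : 0 ≤ (C + 2 * C' + B ^ 2) / κ := by positivity
  have hz := norm_nonneg (α - p)
  have hd := norm_nonneg (t - α)
  generalize ‖α - p‖ = z at *
  generalize ‖t - α‖ = δ at *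
  generalize ‖t - p‖ = w at *
  -- Otherwise `w ≤ 2 * z` and `δ * δ ≤ δ * z`, so every term on the right carries the factor `δ *
  -- z`.
  by_cases hzd : z ≤ δ
  · nlinarith
  push Not at hzd
  have hzpos : 0 < z := by linarith
  have h1 : C' * δ * w ≤ C' * δ * (2 * z) := by gcongr; linarith
  have h2 : B ^ 2 * δ * δ ≤ B ^ 2 * δ * z := by gcongr
  have h3 : κ * z * z ≤ (C + 2 * C' + B ^ 2) * δ * z := by nlinarith
  have h4 := le_of_mul_le_mul_right h3 hzpos
  have h5 : z ≤ (C + 2 * C' + B ^ 2) / κ * δ := by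
    rw [div_mul_eq_mul_div, le_div_iff₀ hκ]
    linarith
  linarith

end LinearBox

/-! ### Reduction of the three conditions to the two cases. -/

lemma boxed_eq_of_ne_top {g : ℝ → EReal} {a b : EReal} {x : ℝ} (h : boxed g a b x ≠ ⊤) :
    boxed g a b x = g x := by
  unfold boxed at h ⊢
  split_ifs at h ⊢ <;> simp_all

end CompositeQP

open CompositeQP in
theorem mainTheorem3 {n : ℕ} (Q : Matrix (Fin n) (Fin n) ℝ) (hQ : Q.PosSemidef)
    (g : Fin n → ℝ → EReal) (hg : ∀ i, CompositeQP.IsClosedConvex (g i))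
    (a b : Fin n → EReal)
    (h0 : CompositeQP.objective Q g a b 0 < ⊤)
    (h : Q.PosDef ∨
      CompositeQP.StronglyConvexOnIterates g (CompositeQP.objective Q g a b) ∨
      CompositeQP.LinearWithBox g a b) :
    CompositeQP.GlobalErrorBoundFromBeginning (CompositeQP.objective Q g a b) := by
  have hf := isSeparableModel_objective Q g hg a b h0
  rcases h with h | h | h
  · obtain ⟨l, hl0, hl⟩ := exists_quad_lower_bound h
    exact hf.globalErrorBound_of_stronglyConvex hQ (fun i => subset_rfl) le_rfl hl0.le
      (by linarith) (fun i => strongConvexOn_zero.2 (hf.convexOn i))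
      (fun x hx => hf.mem_of_mem_initialLevelSet hx) hl
  · choose m hm hmH using h
    obtain ⟨r, hr, hrm⟩ := exists_pos_forall_le m hm
    have hED : ∀ i, (fun α : EuclideanSpace ℝ (Fin n) => α i) '' initialLevelSet
        (objective Q g a b) ⊆ {x | boxed (g i) (a i) (b i) x ≠ ⊤} := by
      rintro i _ ⟨x, hx, rfl⟩
      exact hf.mem_of_mem_initialLevelSet hx i
    -- Here all curvature comes from the `g i`, with the common modulus `r`, so the bound for `Q` is
    -- used with `l = 0`.
    refine hf.globalErrorBound_of_stronglyConvex hQ hED hr.le le_rfl (by linarith) (fun i => ?_)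
      (fun x hx i => ⟨x, hx, rfl⟩) fun x => by simpa using quad_nonneg x hQ
    have hi := (hmH i).mono (hrm i)
    refine ⟨hi.1, fun x hx y hy s t hs ht hst => ?_⟩
    have key := hi.2 hx hy hs ht hst
    simp only [boxed_eq_of_ne_top (hED i hx), boxed_eq_of_ne_top (hED i hy),
      boxed_eq_of_ne_top (hED i (hi.1 hx hy hs ht hst))]
    exact key
  · choose l u c d ha hb hc using h
    have hD : ∀ i, {x | boxed (g i) (a i) (b i) x ≠ ⊤} = Set.Icc (l i) (u i) := by
      intro i
      ext x
      by_cases hx : x ∈ Set.Icc (l i) (u i)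
      · have h1 : (l i : EReal) ≤ x ∧ (x : EReal) ≤ u i := by exact_mod_cast hx
        have h2 : boxed (g i) (a i) (b i) x ≠ ⊤ := by
          rw [boxed, ha, hb, if_pos h1, hc i x hx]
          exact EReal.coe_ne_top _
        exact iff_of_true h2 hx
      · have h1 : ¬ ((l i : EReal) ≤ x ∧ (x : EReal) ≤ u i) := by exact_mod_cast hx
        have h2 : boxed (g i) (a i) (b i) x = ⊤ := by rw [boxed, ha, hb, if_neg h1]
        exact iff_of_false (fun h => h h2) hx
    refine hf.globalErrorBound_of_linear hQ (c := WithLp.toLp 2 c) (d := d) hD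
      fun i x hx => ?_
    simp only [boxed_eq_of_ne_top hx]
    rw [hc i x (hD i ▸ hx), EReal.toReal_coe]
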